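/- Let $n\ge 2$, let $\iota\in\mathbb R^n$ be a unit vector and let $\alpha\in(0,1)$. For a probability distribution $P$ on $\mathbb R$, its $\alpha$ upper-quantile is the smallest $q\in\mathbb R$ with $P((q,\infty))\le\alpha$. Let $\mathcal H$ be the group of all orthogonal $n\times n$ matrices and let $\overline H$ be uniformly distributed on $\mathcal H$, that is, according to its Haar probability measure. For fixed $x\in\mathbb R^n$, let $q_\alpha(x)$ be the $\alpha$ upper-quantile of the distribution of $\iota'\overline H x$. The one-sided orthogonal-group-invariance test is $$\phi_\alpha^{\mathcal H}(x)=\mathbb I\{\iota'x>q_\alpha(x)\},$$ where the value $1$ means rejection. Put $\widehat\sigma(x)=\sqrt{x'(I-\iota\iota')x/(n-1)}$ and let $t_{n-1}^\alpha$ be the $\alpha$ upper-quantile of Student's $t$-distribution with $n-1$ degrees of freedom. Then for every $x\in\mathbb R^n$ with $\widehat\sigma(x)\ne 0$, $$\phi_\alpha^{\mathcal H}(x)=\mathbb I\{\iota'x/\widehat\sigma(x)>t_{n-1}^\alpha\}.$$ In the degenerate case $\widehat\sigma(x)=0$, one has $\phi_\alpha^{\mathcal H}(x)=\mathbb I\{\iota'x>0\}$,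 in accordance with reading $\iota'x/\widehat\sigma(x)$ as $+\infty$ if $\iota'x>0$, and with not rejecting if $\iota'x\le 0$. Since the identity holds for every fixed $x$, it holds for every realization of a random vector $X$ (conditionally on $X$), without any assumption on the distribution of $X$, and in particular without normality. -/

import Mathlib

open MeasureTheory Matrix

noncomputable section

/-- The Borel sigma-algebra on the group of orthogonal `n × n` matrices. -/
instance orthogonalGroupMeasurableSpace (n : ℕ) :
    MeasurableSpace (Matrix.orthogonalGroup (Fin n) ℝ) := borel _

instance orthogonalGroupBorelSpace (n : ℕ) :
    BorelSpace (Matrix.orthogonalGroup (Fin n) ℝ) := ⟨rfl⟩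

instance orthogonalGroupCompactSpace (n : ℕ) :
    CompactSpace (Matrix.orthogonalGroup (Fin n) ℝ) := by
  refine isCompact_iff_compactSpace.mp ?_
  have hK : IsCompact
      (Set.univ.pi fun _ : Fin n => Set.univ.pi fun _ : Fin n => Metric.closedBall (0 : ℝ) 1) :=
    isCompact_univ_pi fun _ => isCompact_univ_pi fun _ => isCompact_closedBall 0 1
  refine IsCompact.of_isClosed_subset hK
    (isClosed_unitary (R := Matrix (Fin n) (Fin n) ℝ)) ?_
  intro U hU
  exact fun i _ j _ => mem_closedBall_zero_iff.mpr (entry_norm_bound_of_unitary hU i j)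

/-- The uniform distribution on the group of all orthogonal `n × n` matrices:
its Haar measure, normalised to have total mass `1`. -/
def uniformOrthogonal (n : ℕ) : Measure (Matrix.orthogonalGroup (Fin n) ℝ) :=
  Measure.haarMeasure ⊤

instance uniformOrthogonal_isProbabilityMeasure (n : ℕ) :
    IsProbabilityMeasure (uniformOrthogonal n) :=
  ⟨by simpa [uniformOrthogonal] using
    Measure.haarMeasure_self (K₀ := (⊤ : TopologicalSpace.PositiveCompacts
      (Matrix.orthogonalGroup (Fin n) ℝ)))⟩

/-- The `α` upper-quantile of a distribution `P` on the real line: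
the smallest `q` with `P((q, ∞)) ≤ α`. -/
def upperQuantile (P : Measure ℝ) (α : ℝ) : ℝ :=
  sInf {q : ℝ | P (Set.Ioi q) ≤ ENNReal.ofReal α}

/-- For a fixed vector `x`, the distribution of `ι' H x` when the matrix `H` is uniformly
distributed on the orthogonal group. -/
def invarianceLaw {n : ℕ} (ι x : Fin n → ℝ) : Measure ℝ :=
  (uniformOrthogonal n).map fun H : Matrix.orthogonalGroup (Fin n) ℝ =>
    ι ⬝ᵥ ((H : Matrix (Fin n) (Fin n) ℝ) *ᵥ x)

/-- The one-sided orthogonal-group-invariance test at level `α`, with test statistic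
`x ↦ ι' x`. The value `1` means rejection and the value `0` means no rejection. -/
def orthogonalInvarianceTest {n : ℕ} (ι : Fin n → ℝ) (α : ℝ) (x : Fin n → ℝ) : ℝ :=
  if upperQuantile (invarianceLaw ι x) α < ι ⬝ᵥ x then 1 else 0

/-- The density of Student's `t`-distribution with `ν` degrees of freedom. -/
def studentTPDF (ν : ℝ) (t : ℝ) : ℝ :=
  Real.Gamma ((ν + 1) / 2) / (√(ν * Real.pi) * Real.Gamma (ν / 2)) *
    (1 + t ^ 2 / ν) ^ (-((ν + 1) / 2))

/-- Student's `t`-distribution with `ν` degrees of freedom. -/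
def studentT (ν : ℝ) : Measure ℝ :=
  volume.withDensity fun t => ENNReal.ofReal (studentTPDF ν t)

/-- The estimator `σ̂ = √(x' (I - ι ι') x / (n - 1))`. -/
def sigmaHat {n : ℕ} (ι x : Fin n → ℝ) : ℝ :=
  √((x ⬝ᵥ ((1 - vecMulVec ι ι) *ᵥ x)) / ((n : ℝ) - 1))

end

/-! The law of `ι'Hx` depends only on `|x|`, and `ι'Hx > q` with `|q| < |x|` says that the slope
`ι'Hx / √(|x|² - (ι'Hx)²)` exceeds `q / √(|x|² - q²)`. Slopes are scale invariant, so this event has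
the same probability for every nonzero `z` in place of `x`. Averaging over `z` with weight `exp
(-|z|²)` and exchanging integrals removes `H`, because volume and weight are rotation invariant
(`lintegral_uniformOrthogonal_mul_exp`). What remains is the law of `u / |v|` for Gaussian `(u, v)`
in `ℝ × ℝ^m`, `m = n - 1`, which is Student's `t` up to the factor `√m`. Since `q ↦ √m q / √(|x|² -
q²)` is an increasing bijection from `(-|x|, |x|)` onto `ℝ`, quantile comparisons transfer without
computing any quantile. The degenerate case is `ι'x = ±|x|`, an endpoint of that interval. -/

lemma upperQuantile_lt_iff (P : Measure ℝ) [IsProbabilityMeasure P] {α : ℝ} (hα₀ : 0 < α)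
    (hα₁ : α < 1) (a : ℝ) :
    upperQuantile P α < a ↔ ∃ q < a, P (Set.Ioi q) ≤ ENNReal.ofReal α := by
  have htop : Filter.Tendsto (fun q : ℝ => P (Set.Ioi q)) Filter.atTop (nhds 0) := by
    have h := tendsto_measure_iInter_atTop (μ := P) (s := fun q : ℝ => Set.Ioi q)
      (fun q => measurableSet_Ioi.nullMeasurableSet) (fun _ _ h => Set.Ioi_subset_Ioi h)
      ⟨0, measure_ne_top _ _⟩
    have he : ⋂ q : ℝ, Set.Ioi q = ∅ :=
      Set.eq_empty_of_forall_notMem fun y hy => lt_irrefl y (Set.mem_iInter.mp hy y)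
    simpa [he, Function.comp_def] using h
  have hbot : Filter.Tendsto (fun q : ℝ => P (Set.Ioi q)) Filter.atBot (nhds 1) := by
    have h := tendsto_measure_iUnion_atBot (μ := P) (s := fun q : ℝ => Set.Ioi q)
      (fun _ _ h => Set.Ioi_subset_Ioi h)
    have he : ⋃ q : ℝ, Set.Ioi q = Set.univ :=
      Set.eq_univ_of_forall fun y => Set.mem_iUnion.mpr ⟨y - 1, by simp⟩
    simpa [he, Function.comp_def] using h
  -- `α > 0` makes the set nonempty and `α < 1` bounds it below, so `sInf` is a genuine infimum and
  -- not the default `0`.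
  have hne : {q : ℝ | P (Set.Ioi q) ≤ ENNReal.ofReal α}.Nonempty := by
    obtain ⟨q, hq⟩ := (htop.eventually (gt_mem_nhds (ENNReal.ofReal_pos.mpr hα₀))).exists
    exact ⟨q, hq.le⟩
  have hbdd : BddBelow {q : ℝ | P (Set.Ioi q) ≤ ENNReal.ofReal α} := by
    have h1 : ENNReal.ofReal α < 1 := by simpa using hα₁
    obtain ⟨b, hb⟩ := (hbot.eventually (lt_mem_nhds h1)).exists
    refine ⟨b, fun q hq => ?_⟩
    by_contra hlt
    exact absurd (hb.trans_le (measure_mono (Set.Ioi_subset_Ioi (not_le.mp hlt).le)))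
      (not_lt.mpr hq)
  rw [upperQuantile, csInf_lt_iff hbdd hne]
  exact ⟨fun ⟨q, hq, h⟩ => ⟨q, h, hq⟩, fun ⟨q, h, hq⟩ => ⟨q, hq, h⟩⟩

/-! ### Orthogonal matrices and invariance of the law -/

lemma dotProduct_orthogonal_mulVec {n : ℕ} (H : Matrix.orthogonalGroup (Fin n) ℝ)
    (x y : Fin n → ℝ) :
    ((H : Matrix (Fin n) (Fin n) ℝ) *ᵥ x) ⬝ᵥ ((H : Matrix (Fin n) (Fin n) ℝ) *ᵥ y) = x ⬝ᵥ y := by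
  have h : (H : Matrix (Fin n) (Fin n) ℝ)ᵀ * (H : Matrix (Fin n) (Fin n) ℝ) = 1 :=
    (Matrix.mem_orthogonalGroup_iff' (Fin n) ℝ).mp H.2
  rw [Matrix.dotProduct_mulVec, Matrix.vecMul_mulVec, ← Matrix.dotProduct_mulVec, h, one_mulVec]

/-- The orthogonal group acts transitively on spheres. -/
lemma exists_orthogonal_mulVec_eq {n : ℕ} {x y : Fin n → ℝ} (h : x ⬝ᵥ x = y ⬝ᵥ y) :
    ∃ K : Matrix.orthogonalGroup (Fin n) ℝ, (K : Matrix (Fin n) (Fin n) ℝ) *ᵥ x = y := by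
  by_cases hxy : x = y
  · exact ⟨1, by simp [hxy]⟩
  set d := x - y with hd
  have hd0 : d ⬝ᵥ d ≠ 0 := by
    rw [Ne, dotProduct_self_eq_zero]
    exact sub_ne_zero.mpr hxy
  have hdx : 2 * (d ⬝ᵥ x) = d ⬝ᵥ d := by
    simp only [hd, sub_dotProduct, dotProduct_sub, dotProduct_comm y x]
    linarith
  -- The Householder reflection along `x - y` exchanges two vectors of equal length.
  set K : Matrix (Fin n) (Fin n) ℝ := 1 - (2 / (d ⬝ᵥ d)) • vecMulVec d d with hK
  have hKT : Kᵀ = K := by simp [hK, transpose_sub, transpose_smul, transpose_vecMulVec]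
  have hmem : K ∈ Matrix.orthogonalGroup (Fin n) ℝ := by
    rw [Matrix.mem_orthogonalGroup_iff]
    change K * Kᵀ = 1
    rw [hKT, hK]
    simp only [sub_mul, mul_sub, one_mul, mul_one, smul_mul_assoc, mul_smul_comm,
      vecMulVec_mul_vecMulVec]
    ext i j
    simp [vecMulVec_apply]
    field_simp
    ring
  refine ⟨⟨K, hmem⟩, ?_⟩
  change K *ᵥ x = y
  ext i
  simp only [hK, sub_mulVec, one_mulVec, smul_mulVec, vecMulVec_mulVec, Pi.sub_apply,
    Pi.smul_apply, smul_eq_mul, MulOpposite.smul_eq_mul_unop, MulOpposite.unop_op]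
  have : 2 / (d ⬝ᵥ d) * (d i * (d ⬝ᵥ x)) = d i := by
    field_simp; linear_combination (d i) * hdx
  rw [this]; simp [hd]

instance uniformOrthogonal_isHaarMeasure (n : ℕ) : (uniformOrthogonal n).IsHaarMeasure := by
  unfold uniformOrthogonal; infer_instance

/-- A right translate of Haar measure is again a left Haar probability measure, hence the same one
by uniqueness. -/
instance uniformOrthogonal_isMulRightInvariant (n : ℕ) :
    (uniformOrthogonal n).IsMulRightInvariant := by
  refine ⟨fun g => ?_⟩
  have : IsProbabilityMeasure (Measure.map (· * g) (uniformOrthogonal n)) :=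
    Measure.isProbabilityMeasure_map (by fun_prop)
  exact Measure.isHaarMeasure_eq_of_isProbabilityMeasure _ _

lemma volume_preserving_orthogonal_mulVec {n : ℕ} (H : Matrix.orthogonalGroup (Fin n) ℝ) :
    MeasurePreserving (fun z : Fin n → ℝ => (H : Matrix (Fin n) (Fin n) ℝ) *ᵥ z) := by
  have h : (H : Matrix (Fin n) (Fin n) ℝ) * (H : Matrix (Fin n) (Fin n) ℝ)ᵀ = 1 :=
    (Matrix.mem_orthogonalGroup_iff (Fin n) ℝ).mp H.2
  have hdet : det (H : Matrix (Fin n) (Fin n) ℝ) * det (H : Matrix (Fin n) (Fin n) ℝ) = 1 := by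
    have := congrArg det h
    simpa [det_mul] using this
  have habs : |(det (H : Matrix (Fin n) (Fin n) ℝ))⁻¹| = 1 := by
    rw [abs_inv]
    have : |det (H : Matrix (Fin n) (Fin n) ℝ)| * |det (H : Matrix (Fin n) (Fin n) ℝ)| = 1 := by
      rw [← abs_mul, hdet, abs_one]
    have h0 := abs_nonneg (det (H : Matrix (Fin n) (Fin n) ℝ))
    have : |det (H : Matrix (Fin n) (Fin n) ℝ)| = 1 := by nlinarith
    rw [this, inv_one]
  refine ⟨by fun_prop, ?_⟩
  have := Real.map_matrix_volume_pi_eq_smul_volume_pi (M := (H : Matrix (Fin n) (Fin n) ℝ))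
    (left_ne_zero_of_mul_eq_one hdet)
  rw [habs, ENNReal.ofReal_one, one_smul] at this
  exact this

lemma measurable_dotProduct_orthogonal_mulVec {n : ℕ} (ι x : Fin n → ℝ) :
    Measurable fun H : Matrix.orthogonalGroup (Fin n) ℝ =>
      ι ⬝ᵥ ((H : Matrix (Fin n) (Fin n) ℝ) *ᵥ x) := by
  have : Continuous fun H : Matrix.orthogonalGroup (Fin n) ℝ =>
      ι ⬝ᵥ ((H : Matrix (Fin n) (Fin n) ℝ) *ᵥ x) := by fun_prop
  exact this.measurable

instance invarianceLaw_isProbabilityMeasure {n : ℕ} (ι x : Fin n → ℝ) :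
    IsProbabilityMeasure (invarianceLaw ι x) :=
  Measure.isProbabilityMeasure_map (measurable_dotProduct_orthogonal_mulVec ι x).aemeasurable

lemma invarianceLaw_apply {n : ℕ} (ι x : Fin n → ℝ) {B : Set ℝ} (hB : MeasurableSet B) :
    invarianceLaw ι x B =
      uniformOrthogonal n {H | ι ⬝ᵥ ((H : Matrix (Fin n) (Fin n) ℝ) *ᵥ x) ∈ B} :=
  Measure.map_apply (measurable_dotProduct_orthogonal_mulVec ι x) hB

/-- With `y = K x`, right translation by `K` absorbs `K` into `H`. -/
lemma invarianceLaw_eq_of_dotProduct_self_eq {n : ℕ} (ι : Fin n → ℝ) {x y : Fin n → ℝ}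
    (h : x ⬝ᵥ x = y ⬝ᵥ y) : invarianceLaw ι x = invarianceLaw ι y := by
  obtain ⟨K, rfl⟩ := exists_orthogonal_mulVec_eq h
  rw [invarianceLaw, ← map_mul_right_eq_self (uniformOrthogonal n) K,
    Measure.map_map (measurable_dotProduct_orthogonal_mulVec ι _) (by fun_prop)]
  simp only [invarianceLaw, Function.comp_def, Submonoid.coe_mul, mulVec_mulVec]

/-- Monotonicity of `q ↦ q / √(r² - q²)` with denominators cleared, so that the endpoints `u = ±r`
are allowed. -/
lemma mul_sqrt_lt_mul_sqrt_iff {r q u : ℝ} (hq : q ^ 2 < r ^ 2) (hu : u ^ 2 ≤ r ^ 2) :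
    q * √(r ^ 2 - u ^ 2) < u * √(r ^ 2 - q ^ 2) ↔ q < u := by
  have hQ : 0 < √(r ^ 2 - q ^ 2) := Real.sqrt_pos.mpr (by linarith)
  have hU : 0 ≤ √(r ^ 2 - u ^ 2) := Real.sqrt_nonneg _
  have hQ2 : √(r ^ 2 - q ^ 2) ^ 2 = r ^ 2 - q ^ 2 := Real.sq_sqrt (by linarith)
  have hU2 : √(r ^ 2 - u ^ 2) ^ 2 = r ^ 2 - u ^ 2 := Real.sq_sqrt (by linarith)
  set Q := √(r ^ 2 - q ^ 2)
  set U := √(r ^ 2 - u ^ 2)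
  have hr : 0 < r ^ 2 := by nlinarith [sq_nonneg q]
  have key : (u * Q) ^ 2 - (q * U) ^ 2 = r ^ 2 * (u ^ 2 - q ^ 2) := by
    rw [mul_pow, mul_pow, hQ2, hU2]; ring
  constructor
  · intro h
    by_contra! hle
    rcases le_total 0 u with hu0 | hu0
    · have h1 := pow_lt_pow_left₀ h (mul_nonneg (hu0.trans hle) hU) two_ne_zero
      have h2 := mul_nonneg hr.le (sub_nonneg.mpr (pow_le_pow_left₀ hu0 hle 2))
      linarith
    · rcases le_total 0 q with hq0 | hq0
      · linarith [mul_nonneg hq0 hU, mul_nonneg (neg_nonneg.mpr hu0) hQ.le]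
      · have h0 : -(u * Q) < -(q * U) := neg_lt_neg h
        have h1 := pow_lt_pow_left₀ h0
          (by rw [← neg_mul]; exact mul_nonneg (neg_nonneg.mpr hu0) hQ.le) two_ne_zero
        have h2 := mul_nonneg hr.le
          (sub_nonneg.mpr (pow_le_pow_left₀ (neg_nonneg.mpr hq0) (neg_le_neg hle) 2))
        linarith
  · intro h
    by_contra! hle
    rcases le_total 0 q with hq0 | hq0
    · have h1 := pow_le_pow_left₀ (mul_nonneg (hq0.trans h.le) hQ.le) hle 2
      have h2 := mul_pos hr (sub_pos.mpr (pow_lt_pow_left₀ h hq0 two_ne_zero))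
      linarith
    · rcases le_or_gt u 0 with hu0 | hu0
      · have h0 : -(q * U) ≤ -(u * Q) := neg_le_neg hle
        have h1 := pow_le_pow_left₀
          (by rw [← neg_mul]; exact mul_nonneg (neg_nonneg.mpr hq0) hU) h0 2
        have h2 := mul_pos hr
          (sub_pos.mpr (pow_lt_pow_left₀ (neg_lt_neg h) (neg_nonneg.mpr hu0) two_ne_zero))
        linarith
      · linarith [mul_nonneg (neg_nonneg.mpr hq0) hU, mul_pos hu0 hQ]

/-! ### Gaussian integrals and the density of the ratio -/

lemma lintegral_eq_mul_lintegral_comp_smul {E : Type*} [NormedAddCommGroup E] [NormedSpace ℝ E]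
    [MeasurableSpace E] [BorelSpace E] [FiniteDimensional ℝ E] (μ : Measure E)
    [μ.IsAddHaarMeasure] {c : ℝ} (hc : 0 < c) {f : E → ENNReal} (hf : Measurable f) :
    ∫⁻ x, f x ∂μ = ENNReal.ofReal (c ^ Module.finrank ℝ E) * ∫⁻ x, f (c • x) ∂μ := by
  have hd : 0 < c ^ Module.finrank ℝ E := pow_pos hc _
  rw [← lintegral_map (μ := μ) (g := fun x => c • x) hf (by fun_prop),
    Measure.map_addHaar_smul μ hc.ne', lintegral_smul_measure, smul_eq_mul, ← mul_assoc,
    ← ENNReal.ofReal_mul hd.le, abs_of_pos (inv_pos.mpr hd), mul_inv_cancel₀ hd.ne',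
    ENNReal.ofReal_one, one_mul]

/-- A constant multiple of the density of `u / ‖v‖` for a rotation invariant `(u, v)`
with values in `ℝ × ℝ ^ m`. -/
noncomputable def ratioDensity (m : ℕ) (t : ℝ) : ENNReal :=
  ENNReal.ofReal ((1 + t ^ 2) ^ (-(((m : ℝ) + 1) / 2)))

/-- Its value is never needed: it cancels once known to be nonzero and finite. -/
noncomputable def radialConst (m : ℕ) : ENNReal :=
  ∫⁻ v : Fin m → ℝ, ENNReal.ofReal (√(v ⬝ᵥ v) * Real.exp (-(v ⬝ᵥ v)))

lemma measurable_ratioDensity (m : ℕ) : Measurable (ratioDensity m) := by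
  unfold ratioDensity; fun_prop

lemma dotProduct_self_nonneg_real {m : ℕ} (v : Fin m → ℝ) : 0 ≤ v ⬝ᵥ v :=
  Finset.sum_nonneg fun i _ => mul_self_nonneg (v i)

lemma measurable_dotProduct_self (m : ℕ) : Measurable fun v : Fin m → ℝ => v ⬝ᵥ v := by
  have : Continuous fun v : Fin m → ℝ => v ⬝ᵥ v := by fun_prop
  exact this.measurable

/-- Rescale `v` by `√(1 + t²)`: the volume contributes `m` powers and the factor `|v|` one more. -/
lemma lintegral_sqrt_mul_exp (m : ℕ) (t : ℝ) :
    ∫⁻ v : Fin m → ℝ, ENNReal.ofReal (√(v ⬝ᵥ v) * Real.exp (-((1 + t ^ 2) * (v ⬝ᵥ v)))) =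
      radialConst m * ratioDensity m t := by
  have h1 : 0 < 1 + t ^ 2 := by positivity
  set c := √(1 + t ^ 2) with hc
  have hc0 : 0 < c := Real.sqrt_pos.mpr h1
  have hc2 : c ^ 2 = 1 + t ^ 2 := Real.sq_sqrt h1.le
  have hm := measurable_dotProduct_self m
  have hK := lintegral_eq_mul_lintegral_comp_smul (volume : Measure (Fin m → ℝ)) hc0
    (f := fun v => ENNReal.ofReal (√(v ⬝ᵥ v) * Real.exp (-(v ⬝ᵥ v)))) (by fun_prop)
  have hscale : ∀ v : Fin m → ℝ,
      ENNReal.ofReal (√((c • v) ⬝ᵥ (c • v)) * Real.exp (-((c • v) ⬝ᵥ (c • v)))) =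
        ENNReal.ofReal c *
          ENNReal.ofReal (√(v ⬝ᵥ v) * Real.exp (-((1 + t ^ 2) * (v ⬝ᵥ v)))) := by
    intro v
    have : (c • v) ⬝ᵥ (c • v) = c ^ 2 * (v ⬝ᵥ v) := by simp; ring
    rw [← ENNReal.ofReal_mul hc0.le, this, Real.sqrt_mul (by positivity), Real.sqrt_sq hc0.le, hc2,
      mul_assoc]
  simp_rw [hscale] at hK
  rw [lintegral_const_mul _ (by fun_prop), Module.finrank_fin_fun, ← mul_assoc,
    ← ENNReal.ofReal_mul (by positivity), ← pow_succ] at hK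
  rw [radialConst, hK, ratioDensity, mul_right_comm, ← ENNReal.ofReal_mul (by positivity)]
  have : c ^ (m + 1) * (1 + t ^ 2) ^ (-(((m : ℝ) + 1) / 2)) = 1 := by
    rw [← Real.rpow_natCast, hc, Real.sqrt_eq_rpow, ← Real.rpow_mul h1.le, ← Real.rpow_add h1]
    convert Real.rpow_zero _ using 2
    push_cast; ring
  rw [this, ENNReal.ofReal_one, one_mul]

/-- Split `z = (u, v)` and substitute `u = t |v|`. The Jacobian is `|v|`, and membership in `S`
becomes a condition on `t` alone. -/
lemma lintegral_indicator_mul_exp {m : ℕ} (hm : m ≠ 0) {S : Set (ℝ × ℝ)} (hS : MeasurableSet S)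
    {B : Set ℝ} (hB : MeasurableSet B)
    (hSB : ∀ t ρ : ℝ, 0 < ρ → ((t * ρ, ρ) ∈ S ↔ t ∈ B)) :
    ∫⁻ z : Fin (m + 1) → ℝ, S.indicator 1 (z 0, √(z ⬝ᵥ z - z 0 ^ 2)) *
        ENNReal.ofReal (Real.exp (-(z ⬝ᵥ z))) =
      radialConst m * ∫⁻ t in B, ratioDensity m t := by
  have hd := measurable_dotProduct_self m
  let F : ℝ × (Fin m → ℝ) → ENNReal := fun p => S.indicator 1 (p.1, √(p.2 ⬝ᵥ p.2)) *
    ENNReal.ofReal (Real.exp (-(p.1 ^ 2 + p.2 ⬝ᵥ p.2)))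
  have hF : Measurable F := by
    refine Measurable.mul ?_ (by fun_prop)
    exact (measurable_one.indicator hS).comp (by fun_prop)
  have hFz : ∀ z : Fin (m + 1) → ℝ, S.indicator 1 (z 0, √(z ⬝ᵥ z - z 0 ^ 2)) *
      ENNReal.ofReal (Real.exp (-(z ⬝ᵥ z))) =
        F (MeasurableEquiv.piFinSuccAbove (fun _ : Fin (m + 1) => ℝ) 0 z) := by
    intro z
    have h2 : (MeasurableEquiv.piFinSuccAbove (fun _ : Fin (m + 1) => ℝ) 0 z) =
      (z 0, fun j => z j.succ) := rfl
    have h3 : z ⬝ᵥ z = z 0 ^ 2 + (fun j : Fin m => z j.succ) ⬝ᵥ (fun j => z j.succ) := by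
      simp only [dotProduct, Fin.sum_univ_succ, sq]
    simp only [F, h2, h3, add_sub_cancel_left]
  simp_rw [hFz]
  rw [(volume_preserving_piFinSuccAbove (fun _ : Fin (m + 1) => ℝ) 0).lintegral_comp hF,
    Measure.volume_eq_prod, lintegral_prod_symm _ hF.aemeasurable]
  -- Needed for `v = 0`, where the substitution breaks down, to be a null set.
  have : Nonempty (Fin m) := Fin.pos_iff_nonempty.mp (Nat.pos_of_ne_zero hm)
  have hinner : ∀ᵐ v : Fin m → ℝ, ∫⁻ u : ℝ, F (u, v) = ∫⁻ t : ℝ, B.indicator 1 t *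
      ENNReal.ofReal (√(v ⬝ᵥ v) * Real.exp (-((1 + t ^ 2) * (v ⬝ᵥ v)))) := by
    have h0 : ∀ᵐ v : Fin m → ℝ, v ≠ 0 := Measure.ae_ne volume 0
    filter_upwards [h0] with v hv
    have hvv : 0 < v ⬝ᵥ v := lt_of_le_of_ne (dotProduct_self_nonneg_real v)
      (fun h => hv (dotProduct_self_eq_zero.mp h.symm))
    have hρ : 0 < √(v ⬝ᵥ v) := Real.sqrt_pos.mpr hvv
    have hFv : Measurable fun u => F (u, v) := hF.comp (by fun_prop)
    have hFs : Measurable fun t : ℝ => F (√(v ⬝ᵥ v) • t, v) :=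
      hFv.comp (measurable_const_smul (√(v ⬝ᵥ v)))
    rw [lintegral_eq_mul_lintegral_comp_smul volume hρ hFv, Module.finrank_self, pow_one,
      ← lintegral_const_mul _ hFs]
    refine lintegral_congr fun t => ?_
    have hi : S.indicator (1 : ℝ × ℝ → ENNReal) (√(v ⬝ᵥ v) * t, √(v ⬝ᵥ v)) = B.indicator 1 t := by
      have := hSB t _ hρ
      rw [mul_comm] at this
      by_cases ht : t ∈ B
      · rw [Set.indicator_of_mem ht, Set.indicator_of_mem (this.mpr ht)]; rfl
      · rw [Set.indicator_of_notMem ht, Set.indicator_of_notMem (fun h => ht (this.mp h))]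
    simp only [F, smul_eq_mul, hi]
    rw [mul_left_comm, ← ENNReal.ofReal_mul hρ.le, mul_pow, Real.sq_sqrt hvv.le]
    congr 5
    ring
  rw [lintegral_congr_ae hinner, lintegral_lintegral_swap]
  · rw [← lintegral_indicator hB, ← lintegral_const_mul _ ((measurable_ratioDensity m).indicator hB)]
    refine lintegral_congr fun t => ?_
    rw [lintegral_const_mul _ (by fun_prop), lintegral_sqrt_mul_exp]
    by_cases ht : t ∈ B <;> simp [ht]
  · refine Measurable.aemeasurable (Measurable.mul ?_ (by fun_prop))
    exact (measurable_one.indicator hB).comp (by fun_prop)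

lemma lintegral_exp_neg_dotProduct_self (m : ℕ) :
    ∫⁻ z : Fin m → ℝ, ENNReal.ofReal (Real.exp (-(z ⬝ᵥ z))) ≠ 0 ∧
    ∫⁻ z : Fin m → ℝ, ENNReal.ofReal (Real.exp (-(z ⬝ᵥ z))) ≠ ⊤ := by
  have hd := measurable_dotProduct_self m
  constructor
  · rw [Ne, lintegral_eq_zero_iff (by fun_prop)]
    intro h
    obtain ⟨z, hz⟩ := h.exists
    exact (ENNReal.ofReal_pos.mpr (Real.exp_pos (-(z ⬝ᵥ z)))).ne' hz
  · have hi : Integrable fun z : Fin m → ℝ => ∏ i, Real.exp (-1 * z i ^ 2) :=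
      Integrable.fintype_prod fun _ => integrable_exp_neg_mul_sq one_pos
    have he : (fun z : Fin m → ℝ => ∏ i, Real.exp (-1 * z i ^ 2)) =
        fun z => Real.exp (-(z ⬝ᵥ z)) := by
      ext z
      rw [← Real.exp_sum]
      simp [dotProduct, sq]
    rw [he] at hi
    exact hi.lintegral_lt_top.ne

lemma lintegral_rpow_mul_exp_neg_mul {a r : ℝ} (ha : 0 < a) (hr : 0 < r) :
    ∫⁻ s in Set.Ioi (0 : ℝ), ENNReal.ofReal (s ^ (a - 1) * Real.exp (-(r * s))) =
      ENNReal.ofReal ((1 / r) ^ a * Real.Gamma a) := by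
  have hpos : 0 < (1 / r) ^ a * Real.Gamma a := by
    have := Real.Gamma_pos_of_pos ha
    positivity
  rw [← Real.integral_rpow_mul_exp_neg_mul_Ioi ha hr, ofReal_integral_eq_lintegral_ofReal]
  · by_contra h
    have := integral_undef h
    rw [Real.integral_rpow_mul_exp_neg_mul_Ioi ha hr] at this
    exact hpos.ne' this
  · filter_upwards [ae_restrict_mem measurableSet_Ioi] with s hs
    have : (0 : ℝ) < s := hs
    simp only [Pi.zero_apply]
    positivity

/-- Write `(1 + t²)^(-a)` as a Gamma integral over `s`; after exchanging integrals the one over `t`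
is Gaussian. -/
lemma lintegral_ratioDensity {m : ℕ} (hm : m ≠ 0) :
    ∫⁻ t, ratioDensity m t =
      ENNReal.ofReal (√Real.pi * Real.Gamma ((m : ℝ) / 2) / Real.Gamma (((m : ℝ) + 1) / 2)) := by
  have hm' : (0 : ℝ) < m := by exact_mod_cast Nat.pos_of_ne_zero hm
  set a := ((m : ℝ) + 1) / 2 with ha
  have ha0 : 0 < a := by positivity
  have hG := Real.Gamma_pos_of_pos ha0
  have hswap : ∫⁻ t : ℝ, ∫⁻ s in Set.Ioi (0 : ℝ),
      ENNReal.ofReal (s ^ (a - 1) * Real.exp (-((1 + t ^ 2) * s))) =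
      ∫⁻ s in Set.Ioi (0 : ℝ), ∫⁻ t : ℝ,
        ENNReal.ofReal (s ^ (a - 1) * Real.exp (-((1 + t ^ 2) * s))) :=
    lintegral_lintegral_swap (Measurable.aemeasurable (by fun_prop))
  have hleft : ∀ t : ℝ, ∫⁻ s in Set.Ioi (0 : ℝ),
      ENNReal.ofReal (s ^ (a - 1) * Real.exp (-((1 + t ^ 2) * s))) =
        ENNReal.ofReal (Real.Gamma a) * ratioDensity m t := by
    intro t
    have h1 : 0 < 1 + t ^ 2 := by positivity
    rw [lintegral_rpow_mul_exp_neg_mul ha0 h1, ratioDensity, ← ENNReal.ofReal_mul hG.le,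
      Real.rpow_neg h1.le, one_div, Real.inv_rpow h1.le, mul_comm]
  have hright : ∀ s ∈ Set.Ioi (0 : ℝ), ∫⁻ t : ℝ,
      ENNReal.ofReal (s ^ (a - 1) * Real.exp (-((1 + t ^ 2) * s))) =
        ENNReal.ofReal √Real.pi * ENNReal.ofReal (s ^ ((m : ℝ) / 2 - 1) * Real.exp (-(1 * s))) := by
    intro s hs
    have hs0 : 0 < s := hs
    have : ∀ t : ℝ, s ^ (a - 1) * Real.exp (-((1 + t ^ 2) * s)) =
        (s ^ (a - 1) * Real.exp (-s)) * Real.exp (-s * t ^ 2) := by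
      intro t
      rw [mul_assoc, ← Real.exp_add]; congr 2; ring
    simp_rw [this]
    rw [← ofReal_integral_eq_lintegral_ofReal ((integrable_exp_neg_mul_sq hs0).const_mul _)
      (Filter.Eventually.of_forall fun t => by positivity), integral_const_mul, integral_gaussian,
      ← ENNReal.ofReal_mul (by positivity)]
    congr 1
    rw [Real.sqrt_div Real.pi_pos.le, Real.sqrt_eq_rpow s,
      show a - 1 = ((m : ℝ) / 2 - 1) + 1 / 2 by rw [ha]; ring, Real.rpow_add hs0]
    have : s ^ ((1 : ℝ) / 2) ≠ 0 := (Real.rpow_pos_of_pos hs0 _).ne'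
    field_simp
  simp_rw [hleft] at hswap
  rw [setLIntegral_congr_fun measurableSet_Ioi hright, lintegral_const_mul _ (measurable_ratioDensity m),
    lintegral_const_mul _ (by fun_prop),
    lintegral_rpow_mul_exp_neg_mul (by positivity) one_pos] at hswap
  have hG0 : ENNReal.ofReal (Real.Gamma a) ≠ 0 := (ENNReal.ofReal_pos.mpr hG).ne'
  rw [← ENNReal.mul_right_inj hG0 ENNReal.ofReal_ne_top, hswap, ← ENNReal.ofReal_mul hG.le,
    ← ENNReal.ofReal_mul (Real.sqrt_nonneg _)]
  congr 1
  simp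
  field_simp

/-! ### Averaging over the orthogonal group -/

lemma lintegral_uniformOrthogonal_mul_exp {m : ℕ} {ι : Fin (m + 1) → ℝ} (hι : ι ⬝ᵥ ι = 1)
    {S : Set (ℝ × ℝ)} (hS : MeasurableSet S) :
    ∫⁻ z : Fin (m + 1) → ℝ, uniformOrthogonal (m + 1)
        {H | (ι ⬝ᵥ ((H : Matrix (Fin (m + 1)) (Fin (m + 1)) ℝ) *ᵥ z),
          √(z ⬝ᵥ z - (ι ⬝ᵥ ((H : Matrix (Fin (m + 1)) (Fin (m + 1)) ℝ) *ᵥ z)) ^ 2)) ∈ S} *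
        ENNReal.ofReal (Real.exp (-(z ⬝ᵥ z))) =
      ∫⁻ z : Fin (m + 1) → ℝ, S.indicator 1 (z 0, √(z ⬝ᵥ z - z 0 ^ 2)) *
        ENNReal.ofReal (Real.exp (-(z ⬝ᵥ z))) := by
  have hd := measurable_dotProduct_self (m + 1)
  let G : (Fin (m + 1) → ℝ) → (Fin (m + 1) → ℝ) → ENNReal := fun κ z =>
    S.indicator 1 (κ ⬝ᵥ z, √(z ⬝ᵥ z - (κ ⬝ᵥ z) ^ 2)) * ENNReal.ofReal (Real.exp (-(z ⬝ᵥ z)))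
  have hκ : ∀ κ : Fin (m + 1) → ℝ, Measurable fun z : Fin (m + 1) → ℝ => κ ⬝ᵥ z := fun κ => by
    have : Continuous fun z : Fin (m + 1) → ℝ => κ ⬝ᵥ z := by fun_prop
    exact this.measurable
  have hG : ∀ κ, Measurable (G κ) := fun κ => by
    have := hκ κ
    exact ((measurable_one.indicator hS).comp (by fun_prop)).mul (by fun_prop)
  have hrot : ∀ (κ : Fin (m + 1) → ℝ) (H : Matrix.orthogonalGroup (Fin (m + 1)) ℝ),
      ∫⁻ z, G κ ((H : Matrix (Fin (m + 1)) (Fin (m + 1)) ℝ) *ᵥ z) = ∫⁻ z, G κ z := fun κ H =>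
    (volume_preserving_orthogonal_mulVec H).lintegral_comp (hG κ)
  have hJ : Measurable fun p : (Fin (m + 1) → ℝ) × Matrix.orthogonalGroup (Fin (m + 1)) ℝ =>
      ι ⬝ᵥ ((p.2 : Matrix (Fin (m + 1)) (Fin (m + 1)) ℝ) *ᵥ p.1) := by
    have : Continuous fun p : (Fin (m + 1) → ℝ) × Matrix.orthogonalGroup (Fin (m + 1)) ℝ =>
      ι ⬝ᵥ ((p.2 : Matrix (Fin (m + 1)) (Fin (m + 1)) ℝ) *ᵥ p.1) := by fun_prop
    exact this.measurable
  have hleft : ∀ z : Fin (m + 1) → ℝ, uniformOrthogonal (m + 1)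
      {H | (ι ⬝ᵥ ((H : Matrix (Fin (m + 1)) (Fin (m + 1)) ℝ) *ᵥ z),
        √(z ⬝ᵥ z - (ι ⬝ᵥ ((H : Matrix (Fin (m + 1)) (Fin (m + 1)) ℝ) *ᵥ z)) ^ 2)) ∈ S} *
      ENNReal.ofReal (Real.exp (-(z ⬝ᵥ z))) =
      ∫⁻ H : Matrix.orthogonalGroup (Fin (m + 1)) ℝ,
        G ι ((H : Matrix (Fin (m + 1)) (Fin (m + 1)) ℝ) *ᵥ z) ∂uniformOrthogonal (m + 1) := by
    intro z
    have hz := measurable_dotProduct_orthogonal_mulVec ι z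
    simp only [G, dotProduct_orthogonal_mulVec]
    have hp : Measurable fun H : Matrix.orthogonalGroup (Fin (m + 1)) ℝ =>
        (ι ⬝ᵥ ((H : Matrix (Fin (m + 1)) (Fin (m + 1)) ℝ) *ᵥ z),
        √(z ⬝ᵥ z - (ι ⬝ᵥ ((H : Matrix (Fin (m + 1)) (Fin (m + 1)) ℝ) *ᵥ z)) ^ 2)) := by
      fun_prop
    rw [lintegral_mul_const' _ _ ENNReal.ofReal_ne_top]
    congr 1
    exact (lintegral_indicator_one (hp hS)).symm
  simp_rw [hleft]
  rw [lintegral_lintegral_swap]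
  · simp_rw [hrot]
    rw [lintegral_const, measure_univ, mul_one]
    -- `H` is gone. One more rotation, with `K e₀ = ι`, turns `ι'Kz` into `z 0`.
    obtain ⟨K, hK⟩ := exists_orthogonal_mulVec_eq
      (x := Pi.single (0 : Fin (m + 1)) (1 : ℝ)) (y := ι) (by simp [hι])
    rw [← hrot ι K]
    refine lintegral_congr fun z => ?_
    simp only [G, dotProduct_orthogonal_mulVec]
    rw [← hK, dotProduct_orthogonal_mulVec, single_one_dotProduct]
  · refine Measurable.aemeasurable ?_
    simp only [Function.uncurry_def, G, dotProduct_orthogonal_mulVec]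
    exact ((measurable_one.indicator hS).comp (by fun_prop)).mul (by fun_prop)

lemma sq_dotProduct_le {n : ℕ} {ι : Fin n → ℝ} (hι : ι ⬝ᵥ ι = 1) (x : Fin n → ℝ) :
    (ι ⬝ᵥ x) ^ 2 ≤ x ⬝ᵥ x := by
  have h := Finset.sum_mul_sq_le_sq_mul_sq Finset.univ ι x
  simp only [dotProduct, ← sq] at hι ⊢
  rwa [hι, one_mul] at h

lemma sq_dotProduct_orthogonal_mulVec_le {n : ℕ} {ι : Fin n → ℝ} (hι : ι ⬝ᵥ ι = 1) (x : Fin n → ℝ)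
    (H : Matrix.orthogonalGroup (Fin n) ℝ) :
    (ι ⬝ᵥ ((H : Matrix (Fin n) (Fin n) ℝ) *ᵥ x)) ^ 2 ≤ x ⬝ᵥ x :=
  (sq_dotProduct_le hι _).trans_eq (dotProduct_orthogonal_mulVec H x x)

/-- The event depends on `z` only through `|z|` in law, so `z` may be replaced by a positive
multiple of `x`, and the multiple drops out by homogeneity. -/
lemma uniformOrthogonal_slope_eq {n : ℕ} {ι : Fin n → ℝ} (hι : ι ⬝ᵥ ι = 1) {x z : Fin n → ℝ}
    (hx : x ≠ 0) (hz : z ≠ 0) {q : ℝ} (hq : q ^ 2 < x ⬝ᵥ x) :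
    uniformOrthogonal n {H | q / √(x ⬝ᵥ x - q ^ 2) *
        √(z ⬝ᵥ z - (ι ⬝ᵥ ((H : Matrix (Fin n) (Fin n) ℝ) *ᵥ z)) ^ 2) <
          ι ⬝ᵥ ((H : Matrix (Fin n) (Fin n) ℝ) *ᵥ z)} =
      invarianceLaw ι x (Set.Ioi q) := by
  have hpos : ∀ y : Fin n → ℝ, y ≠ 0 → 0 < y ⬝ᵥ y := fun y hy =>
    lt_of_le_of_ne (dotProduct_self_nonneg_real y) fun h => hy (dotProduct_self_eq_zero.mp h.symm)
  set r := √(x ⬝ᵥ x)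
  have hr0 : 0 < r := Real.sqrt_pos.mpr (hpos x hx)
  have hr : r ^ 2 = x ⬝ᵥ x := Real.sq_sqrt (hpos x hx).le
  set p := √(z ⬝ᵥ z)
  have hp0 : 0 < p := Real.sqrt_pos.mpr (hpos z hz)
  have hp : p ^ 2 = z ⬝ᵥ z := Real.sq_sqrt (hpos z hz).le
  have hl0 : 0 < p / r := div_pos hp0 hr0
  have hzz : z ⬝ᵥ z = ((p / r) • x) ⬝ᵥ ((p / r) • x) := by
    simp only [dotProduct_smul, smul_dotProduct, smul_eq_mul, ← hr, ← hp]
    field_simp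
  have hQ : 0 < √(x ⬝ᵥ x - q ^ 2) := Real.sqrt_pos.mpr (by linarith)
  let B : Set ℝ := {u | q / √(x ⬝ᵥ x - q ^ 2) * √(z ⬝ᵥ z - u ^ 2) < u}
  have hB : MeasurableSet B := measurableSet_lt (by fun_prop) measurable_id
  calc _ = invarianceLaw ι z B := (invarianceLaw_apply ι z hB).symm
    _ = invarianceLaw ι ((p / r) • x) B := by rw [invarianceLaw_eq_of_dotProduct_self_eq ι hzz]
    _ = invarianceLaw ι x (Set.Ioi q) := by
      rw [invarianceLaw_apply _ _ hB, invarianceLaw_apply _ _ measurableSet_Ioi]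
      congr 1
      ext H
      have hu := sq_dotProduct_orthogonal_mulVec_le hι x H
      simp only [B, Set.mem_ofPred_eq, mulVec_smul, dotProduct_smul, Set.mem_Ioi, smul_eq_mul, hzz,
        smul_dotProduct]
      set u := ι ⬝ᵥ ((H : Matrix (Fin n) (Fin n) ℝ) *ᵥ x)
      rw [show p / r * (p / r * x ⬝ᵥ x) - (p / r * u) ^ 2 = (p / r) ^ 2 * (x ⬝ᵥ x - u ^ 2) by ring,
        Real.sqrt_mul (by positivity), Real.sqrt_sq hl0.le, mul_left_comm,
        mul_lt_mul_iff_right₀ hl0, div_mul_eq_mul_div, div_lt_iff₀ hQ, ← hr]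
      exact mul_sqrt_lt_mul_sqrt_iff (hr ▸ hq) (hr ▸ hu)

lemma radialConst_mul_lintegral_ratioDensity {m : ℕ} (hm : m ≠ 0) :
    radialConst m * ∫⁻ t, ratioDensity m t =
      ∫⁻ z : Fin (m + 1) → ℝ, ENNReal.ofReal (Real.exp (-(z ⬝ᵥ z))) := by
  have h := lintegral_indicator_mul_exp hm MeasurableSet.univ MeasurableSet.univ
    (fun t ρ _ => by simp)
  simpa using h.symm

/-- The Gaussian average of the slope probability, computed in two ways: as a constant in `z ≠ 0`,
and through `ratioDensity`. Then `radialConst` cancels. -/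
lemma invarianceLaw_Ioi_mul_lintegral {m : ℕ} (hm : m ≠ 0) {ι : Fin (m + 1) → ℝ}
    (hι : ι ⬝ᵥ ι = 1) {x : Fin (m + 1) → ℝ} {q : ℝ} (hq : q ^ 2 < x ⬝ᵥ x) :
    invarianceLaw ι x (Set.Ioi q) * ∫⁻ t, ratioDensity m t =
      ∫⁻ t in Set.Ioi (q / √(x ⬝ᵥ x - q ^ 2)), ratioDensity m t := by
  have hx : x ≠ 0 := by
    rintro rfl
    simp only [dotProduct_zero] at hq
    exact absurd hq (not_lt.mpr (sq_nonneg q))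
  set s := q / √(x ⬝ᵥ x - q ^ 2) with hs
  let S : Set (ℝ × ℝ) := {p | s * p.2 < p.1}
  have hS : MeasurableSet S := measurableSet_lt (by fun_prop) (by fun_prop)
  have h1 := lintegral_indicator_mul_exp hm hS measurableSet_Ioi (B := Set.Ioi s)
    (fun t ρ hρ => by simp [S, mul_lt_mul_iff_left₀ hρ])
  rw [← lintegral_uniformOrthogonal_mul_exp hι hS] at h1
  have h0 : ∀ᵐ z : Fin (m + 1) → ℝ, z ≠ 0 := Measure.ae_ne volume 0
  rw [lintegral_congr_ae (g := fun z => invarianceLaw ι x (Set.Ioi q) *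
    ENNReal.ofReal (Real.exp (-(z ⬝ᵥ z))))] at h1
  · have hd := measurable_dotProduct_self (m + 1)
    rw [lintegral_const_mul _ (by fun_prop), ← radialConst_mul_lintegral_ratioDensity hm,
      mul_left_comm] at h1
    obtain ⟨hW0, hWt⟩ := lintegral_exp_neg_dotProduct_self (m + 1)
    rw [← radialConst_mul_lintegral_ratioDensity hm] at hW0 hWt
    have hK0 : radialConst m ≠ 0 := left_ne_zero_of_mul hW0
    have hKt : radialConst m ≠ ⊤ := fun h =>
      hWt (by rw [h, ENNReal.top_mul (right_ne_zero_of_mul hW0)])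
    exact (ENNReal.mul_right_inj hK0 hKt).mp h1
  · filter_upwards [h0] with z hz
    rw [← uniformOrthogonal_slope_eq hι hx hz hq]
    rfl

/-! ### Identification with Student's distribution -/

lemma studentT_apply {m : ℕ} (hm : m ≠ 0) {B : Set ℝ} (hB : MeasurableSet B) :
    studentT m B * ∫⁻ t, ratioDensity m t =
      ∫⁻ t in (fun t => √(m : ℝ) * t) ⁻¹' B, ratioDensity m t := by
  have hm' : (0 : ℝ) < m := by exact_mod_cast Nat.pos_of_ne_zero hm
  have hsm : 0 < √(m : ℝ) := Real.sqrt_pos.mpr hm'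
  have hG1 : 0 < Real.Gamma (((m : ℝ) + 1) / 2) := Real.Gamma_pos_of_pos (by positivity)
  have hG2 : 0 < Real.Gamma ((m : ℝ) / 2) := Real.Gamma_pos_of_pos (by positivity)
  have hmeas : Measurable fun t => ENNReal.ofReal (studentTPDF m t) := by
    unfold studentTPDF; fun_prop
  have hpre : MeasurableSet ((fun t => √(m : ℝ) * t) ⁻¹' B) := (measurable_const_mul _) hB
  have hind : Measurable fun t : ℝ =>
      B.indicator (fun t => ENNReal.ofReal (studentTPDF m t)) (√(m : ℝ) • t) :=
    (hmeas.indicator hB).comp (measurable_const_smul (√(m : ℝ)))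
  rw [studentT, withDensity_apply _ hB, ← lintegral_indicator hB,
    lintegral_eq_mul_lintegral_comp_smul volume hsm (hmeas.indicator hB), Module.finrank_self,
    pow_one, ← lintegral_const_mul _ hind,
    lintegral_ratioDensity hm, ← lintegral_mul_const _ (hind.const_mul _),
    ← lintegral_indicator hpre]
  refine lintegral_congr fun t => ?_
  by_cases ht : √(m : ℝ) * t ∈ B
  · have ht' : t ∈ (fun t => √(m : ℝ) * t) ⁻¹' B := ht
    simp only [smul_eq_mul]
    rw [Set.indicator_of_mem ht, Set.indicator_of_mem ht', ← ENNReal.ofReal_mul hsm.le,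
      ← ENNReal.ofReal_mul (by unfold studentTPDF; positivity), ratioDensity, studentTPDF,
      Real.sqrt_mul hm'.le, mul_pow, Real.sq_sqrt hm'.le, mul_div_cancel_left₀ _ hm'.ne']
    congr 1
    have := Real.sqrt_pos.mpr Real.pi_pos
    field_simp
  · have ht' : t ∉ (fun t => √(m : ℝ) * t) ⁻¹' B := ht
    simp only [smul_eq_mul]
    rw [Set.indicator_of_notMem ht, Set.indicator_of_notMem ht']
    simp

lemma lintegral_ratioDensity_ne {m : ℕ} (hm : m ≠ 0) :
    ∫⁻ t, ratioDensity m t ≠ 0 ∧ ∫⁻ t, ratioDensity m t ≠ ⊤ := by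
  have hm' : (0 : ℝ) < m := by exact_mod_cast Nat.pos_of_ne_zero hm
  have hG1 : 0 < Real.Gamma (((m : ℝ) + 1) / 2) := Real.Gamma_pos_of_pos (by positivity)
  have hG2 : 0 < Real.Gamma ((m : ℝ) / 2) := Real.Gamma_pos_of_pos (by positivity)
  have := Real.sqrt_pos.mpr Real.pi_pos
  rw [lintegral_ratioDensity hm]
  exact ⟨(ENNReal.ofReal_pos.mpr (by positivity)).ne', ENNReal.ofReal_ne_top⟩

lemma studentT_isProbabilityMeasure {m : ℕ} (hm : m ≠ 0) : IsProbabilityMeasure (studentT m) := by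
  obtain ⟨h0, ht⟩ := lintegral_ratioDensity_ne hm
  refine ⟨?_⟩
  have h := studentT_apply hm MeasurableSet.univ
  rw [Set.preimage_univ, setLIntegral_univ] at h
  rw [← ENNReal.mul_left_inj h0 ht, h, one_mul]

/-- The tails of `ι' H x` are those of Student's `t`-distribution, after an increasing change of
variable. -/
lemma invarianceLaw_Ioi_eq_studentT {m : ℕ} (hm : m ≠ 0) {ι : Fin (m + 1) → ℝ}
    (hι : ι ⬝ᵥ ι = 1) {x : Fin (m + 1) → ℝ} {q : ℝ} (hq : q ^ 2 < x ⬝ᵥ x) :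
    invarianceLaw ι x (Set.Ioi q) =
      studentT m (Set.Ioi (√(m : ℝ) * (q / √(x ⬝ᵥ x - q ^ 2)))) := by
  obtain ⟨h0, ht⟩ := lintegral_ratioDensity_ne hm
  have hsm : 0 < √(m : ℝ) := Real.sqrt_pos.mpr (by exact_mod_cast Nat.pos_of_ne_zero hm)
  rw [← ENNReal.mul_left_inj h0 ht, invarianceLaw_Ioi_mul_lintegral hm hι hq,
    studentT_apply hm measurableSet_Ioi]
  congr 2
  ext t
  simp [mul_lt_mul_iff_right₀ hsm]

/-! ### The change of variable and the comparison of quantiles -/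

lemma exists_div_sqrt_eq {R : ℝ} (hR : 0 < R) (s : ℝ) :
    ∃ q : ℝ, q ^ 2 < R ∧ q / √(R - q ^ 2) = s := by
  have h1 : 0 < 1 + s ^ 2 := by positivity
  have hsR := Real.sqrt_pos.mpr hR
  have hs1 := Real.sqrt_pos.mpr h1
  have hq : (s * √R / √(1 + s ^ 2)) ^ 2 = s ^ 2 * R / (1 + s ^ 2) := by
    rw [div_pow, mul_pow, Real.sq_sqrt hR.le, Real.sq_sqrt h1.le]
  have hsub : R - s ^ 2 * R / (1 + s ^ 2) = R / (1 + s ^ 2) := by field_simp; ring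
  refine ⟨s * √R / √(1 + s ^ 2), ?_, ?_⟩
  · rw [hq, ← sub_pos, hsub]; positivity
  · rw [hq, hsub, Real.sqrt_div hR.le]; field_simp

lemma div_sqrt_lt_div_sqrt_iff {R q u : ℝ} (hq : q ^ 2 < R) (hu : u ^ 2 < R) :
    q / √(R - q ^ 2) < u / √(R - u ^ 2) ↔ q < u := by
  have hR : √R ^ 2 = R := Real.sq_sqrt ((sq_nonneg q).trans hq.le)
  rw [div_lt_div_iff₀ (Real.sqrt_pos.mpr (by linarith)) (Real.sqrt_pos.mpr (by linarith))]
  have := mul_sqrt_lt_mul_sqrt_iff (r := √R) (q := q) (u := u) (by rwa [hR]) (by rw [hR]; exact hu.le)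
  rwa [hR] at this

lemma invarianceLaw_Ioi_eq_one {n : ℕ} {ι : Fin n → ℝ} (hι : ι ⬝ᵥ ι = 1) {x : Fin n → ℝ} {q : ℝ}
    (hq : q < -√(x ⬝ᵥ x)) : invarianceLaw ι x (Set.Ioi q) = 1 := by
  rw [invarianceLaw_apply _ _ measurableSet_Ioi]
  convert measure_univ (μ := uniformOrthogonal n)
  refine Set.eq_univ_of_forall fun H => ?_
  have h := Real.abs_le_sqrt (sq_dotProduct_orthogonal_mulVec_le hι x H)
  exact hq.trans_le (neg_le_of_abs_le h)

lemma sigmaHat_eq {n : ℕ} (ι x : Fin n → ℝ) :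
    sigmaHat ι x = √((x ⬝ᵥ x - (ι ⬝ᵥ x) ^ 2) / ((n : ℝ) - 1)) := by
  rw [sigmaHat]
  congr 2
  rw [sub_mulVec, one_mulVec, dotProduct_sub, vecMulVec_mulVec]
  simp [dotProduct_comm x ι, sq]

lemma upperQuantile_invarianceLaw_lt_iff {m : ℕ} (hm : m ≠ 0) {ι : Fin (m + 1) → ℝ}
    (hι : ι ⬝ᵥ ι = 1) {α : ℝ} (hα₀ : 0 < α) (hα₁ : α < 1) {x : Fin (m + 1) → ℝ}
    (hx : (ι ⬝ᵥ x) ^ 2 < x ⬝ᵥ x) :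
    upperQuantile (invarianceLaw ι x) α < ι ⬝ᵥ x ↔
      upperQuantile (studentT m) α < √(m : ℝ) * (ι ⬝ᵥ x / √(x ⬝ᵥ x - (ι ⬝ᵥ x) ^ 2)) := by
  have := studentT_isProbabilityMeasure hm
  have hsm : 0 < √(m : ℝ) := Real.sqrt_pos.mpr (by exact_mod_cast Nat.pos_of_ne_zero hm)
  have hR : 0 < x ⬝ᵥ x := (sq_nonneg _).trans_lt hx
  rw [upperQuantile_lt_iff _ hα₀ hα₁, upperQuantile_lt_iff _ hα₀ hα₁]
  constructor
  · rintro ⟨q, hqa, hq⟩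
    obtain ⟨hl, hu⟩ := Real.sq_lt.mp hx
    -- `q` may lie at or below `-|x|`, outside the range of the change of variable. Raising it to
    -- `max q b` keeps it below `ι'x` and only shrinks the tail.
    obtain ⟨b, hlb, hba⟩ := exists_between hl
    have hq' : max q b ^ 2 < x ⬝ᵥ x :=
      Real.sq_lt.mpr ⟨hlb.trans_le (le_max_right _ _), (max_lt hqa hba).trans hu⟩
    refine ⟨_, ?_, (invarianceLaw_Ioi_eq_studentT hm hι hq').symm.trans_le
      ((measure_mono (Set.Ioi_subset_Ioi (le_max_left _ _))).trans hq)⟩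
    rw [mul_lt_mul_iff_right₀ hsm, div_sqrt_lt_div_sqrt_iff hq' hx]
    exact max_lt hqa hba
  · rintro ⟨t, hta, ht⟩
    obtain ⟨q, hq, hqt⟩ := exists_div_sqrt_eq hR (t / √(m : ℝ))
    have hts : √(m : ℝ) * (t / √(m : ℝ)) = t := mul_div_cancel₀ _ hsm.ne'
    refine ⟨q, ?_, ?_⟩
    · rwa [← div_sqrt_lt_div_sqrt_iff hq hx, hqt, ← mul_lt_mul_iff_right₀ hsm, hts]
    · rwa [invarianceLaw_Ioi_eq_studentT hm hι hq, hqt, hts]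

lemma upperQuantile_invarianceLaw_lt_iff_pos {m : ℕ} (hm : m ≠ 0) {ι : Fin (m + 1) → ℝ}
    (hι : ι ⬝ᵥ ι = 1) {α : ℝ} (hα₀ : 0 < α) (hα₁ : α < 1) {x : Fin (m + 1) → ℝ}
    (hx : (ι ⬝ᵥ x) ^ 2 = x ⬝ᵥ x) :
    upperQuantile (invarianceLaw ι x) α < ι ⬝ᵥ x ↔ 0 < ι ⬝ᵥ x := by
  have := studentT_isProbabilityMeasure hm
  have hsm : 0 < √(m : ℝ) := Real.sqrt_pos.mpr (by exact_mod_cast Nat.pos_of_ne_zero hm)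
  rw [upperQuantile_lt_iff _ hα₀ hα₁]
  constructor
  · rintro ⟨q, hqa, hq⟩
    by_contra! ha
    -- Here `ι'x = -|x|`, the lower end of the range of `ι'Hx`, so the tail beyond `q` has mass `1 >
    -- α`.
    have h1 : q < -√(x ⬝ᵥ x) := by rwa [← hx, Real.sqrt_sq_eq_abs, abs_of_nonpos ha, neg_neg]
    rw [invarianceLaw_Ioi_eq_one hι h1] at hq
    exact absurd hα₁ (not_lt.mpr (ENNReal.one_le_ofReal.mp hq))
  · intro ha
    -- Any real `t` whose tail is at most `α` will do: it pulls back to some `q` strictly below `|x|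
    -- = ι'x`.
    obtain ⟨t, -, ht⟩ := (upperQuantile_lt_iff (studentT m) hα₀ hα₁
      (upperQuantile (studentT m) α + 1)).mp (lt_add_one _)
    obtain ⟨q, hq, hqt⟩ := exists_div_sqrt_eq (hx ▸ pow_pos ha 2) (t / √(m : ℝ))
    refine ⟨q, lt_of_pow_lt_pow_left₀ 2 ha.le (hx ▸ hq), ?_⟩
    rwa [invarianceLaw_Ioi_eq_studentT hm hι hq, hqt, mul_div_cancel₀ _ hsm.ne']

theorem mainTheorem5 (n : ℕ) (hn : 2 ≤ n) (ι : Fin n → ℝ) (hι : ι ⬝ᵥ ι = 1)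
    (α : ℝ) (hα₀ : 0 < α) (hα₁ : α < 1) (x : Fin n → ℝ) :
    (sigmaHat ι x ≠ 0 →
      orthogonalInvarianceTest ι α x =
        if upperQuantile (studentT ((n : ℝ) - 1)) α < (ι ⬝ᵥ x) / sigmaHat ι x
        then 1 else 0) ∧
    (sigmaHat ι x = 0 →
      orthogonalInvarianceTest ι α x = if 0 < ι ⬝ᵥ x then 1 else 0) := by
  obtain ⟨m, rfl⟩ : ∃ m, n = m + 1 := ⟨n - 1, by omega⟩
  have hm : m ≠ 0 := by omega
  have hm' : (0 : ℝ) < m := by exact_mod_cast Nat.pos_of_ne_zero hm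
  have hν : ((m + 1 : ℕ) : ℝ) - 1 = m := by push_cast; ring
  have hle := sq_dotProduct_le hι x
  rw [sigmaHat_eq, hν, orthogonalInvarianceTest]
  constructor
  · intro h
    have hlt : (ι ⬝ᵥ x) ^ 2 < x ⬝ᵥ x := by
      refine lt_of_le_of_ne hle fun he => h ?_
      rw [he, sub_self, zero_div, Real.sqrt_zero]
    have hs : ι ⬝ᵥ x / √((x ⬝ᵥ x - (ι ⬝ᵥ x) ^ 2) / m) =
        √(m : ℝ) * (ι ⬝ᵥ x / √(x ⬝ᵥ x - (ι ⬝ᵥ x) ^ 2)) := by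
      rw [Real.sqrt_div (sub_nonneg.mpr hle), div_div_eq_mul_div, mul_comm, mul_div_assoc]
    simp only [hs, upperQuantile_invarianceLaw_lt_iff hm hι hα₀ hα₁ hlt]
  · intro h
    have he : (ι ⬝ᵥ x) ^ 2 = x ⬝ᵥ x := by
      rw [Real.sqrt_eq_zero (div_nonneg (sub_nonneg.mpr hle) hm'.le), div_eq_zero_iff] at h
      rcases h with h | h
      · linarith
      · exact absurd h hm'.ne'
    simp only [upperQuantile_invarianceLaw_lt_iff_pos hm hι hα₀ hα₁ he]
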